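/- Let $\mathcal F$ be a signature (function symbols with fixed arities), $\mathcal V$ a countably infinite set of variables, and $S$ a set of sorts with a partial order $\succeq$. Let $\mathcal S$ be a sort attachment: it associates with each $f\in\mathcal F$ of arity $n$ a type $f:\alpha_1\times\cdots\times\alpha_n\to\alpha$ with $\alpha_i,\alpha\in S$, and with each variable a sort in $S$, such that for every $\alpha\in S$ the set $\mathcal V_\alpha$ of variables of sort $\alpha$ is countably infinite. The sets $\mathcal T_\alpha$ of order-sorted terms of sort $\alpha$ are defined inductively: $\mathcal V_\alpha\subseteq\mathcal T_\alpha$, and $f(t_1,\dots,t_n)\in\mathcal T_\alpha$ whenever $f:\alpha_1\times\cdots\times\alpha_n\to\alpha$, $t_i\in\mathcal T_{\beta_i}$ and $\alpha_i\succeq\beta_i$ for all $i$. Put $\mathcal T_{\mathcal S}=\bigcup_{\alpha\in S}\mathcal T_\alpha$. A term $t$ is strictly order-sorted if, whenever $f(t_1,\dots,t_n)$ with $f:\alpha_1\times\cdots\times\alpha_n\to\alpha$ is a subterm of $t$ and $t_i$ is a variable of sort $\beta$, then $\alpha_i=\beta$. Let $\mathcal R$ be a term rewrite system over $\mathcal F$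 and $\mathcal V$, i.e. a set of rules $\ell\to r$ between terms such that $\ell$ is not a variable and every variable of $r$ occurs in $\ell$. Suppose that $\mathcal R$ is compatible with $\mathcal S$: for every rule $\ell\to r$ of $\mathcal R$ both sides are order-sorted, say $\ell\in\mathcal T_\alpha$ and $r\in\mathcal T_\beta$, with $\alpha\succeq\beta$, and $\ell$ is strictly order-sorted. Suppose also that $\mathcal R$ is left-linear, i.e. no variable occurs more than once in the left-hand side of a rule. If $\mathcal R$ is confluent on $\mathcal T_{\mathcal S}$ (that is, $\mathcal T_{\mathcal S}$ is closed under $\to_{\mathcal R}$ and the restriction of $\to_{\mathcal R}$ to $\mathcal T_{\mathcal S}$ is confluent), then $\mathcal R$ is confluent on all terms. -/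

import Mathlib

/-!
First-order term rewriting and order-sorted terms.

A signature is a `FirstOrder.Language` (only its function symbols, which carry their arity,
matter), and `L.Term V` is the set of terms over the function symbols of `L` and the variables `V`.
Substitutions are maps `V → L.Term V`, applied by `FirstOrder.Language.Term.subst`.
-/

universe u v w z

namespace OrderSorted

open FirstOrder FirstOrder.Language

section Rewriting

variable {L : FirstOrder.Language.{u, v}} {V : Type w}

/-- The set of variables that occur in a term. -/
def vars : L.Term V → Set V
  | .var x => {x}
  | .func _ ts => ⋃ i, vars (ts i)

open Classical in
/-- The number of occurrences of the variable `x` in a term. -/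
noncomputable def occ (x : V) : L.Term V → ℕ
  | .var y => if y = x then 1 else 0
  | .func _ ts => ∑ i, occ x (ts i)

/-- A term is linear if every variable occurs at most once in it. -/
def Linear (t : L.Term V) : Prop := ∀ x, occ x t ≤ 1

variable (L V) in
/-- Rewrite rules `lhs → rhs`: the left-hand side is not a variable, and every variable of the
right-hand side occurs in the left-hand side. -/
structure Rule where
  lhs : L.Term V
  rhs : L.Term V
  lhs_ne_var : ∀ x : V, lhs ≠ Term.var x
  vars_rhs_subset : vars rhs ⊆ vars lhs

variable (L V) in
/-- A term rewrite system over a fixed signature is an arbitrary set of rewrite rules. -/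
abbrev TRS := Set (Rule L V)

/-- A TRS is left-linear if all its left-hand sides are linear. -/
def LeftLinear (R : TRS L V) : Prop := ∀ ρ ∈ R, Linear ρ.lhs

/-- The rewrite relation: one instance of a left-hand side, at some position, is replaced by the
corresponding instance of the right-hand side. -/
inductive Step (R : TRS L V) : L.Term V → L.Term V → Prop
  | root (ρ : Rule L V) (hρ : ρ ∈ R) (σ : V → L.Term V) :
      Step R (ρ.lhs.subst σ) (ρ.rhs.subst σ)
  | arg {n : ℕ} (f : L.Functions n) (ts : Fin n → L.Term V) (i : Fin n) (u : L.Term V)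
      (h : Step R (ts i) u) :
      Step R (Term.func f ts) (Term.func f (Function.update ts i u))

end Rewriting

section Confluence

variable {A : Type z}

/-- A relation is confluent if any two elements reachable from a common element have a common
reduct. -/
def Confluent (r : A → A → Prop) : Prop :=
  ∀ a b c, Relation.ReflTransGen r a b → Relation.ReflTransGen r a c →
    ∃ d, Relation.ReflTransGen r b d ∧ Relation.ReflTransGen r c d

/-- A relation is confluent on a set `X` if `X` is closed under the relation and the restriction
of the relation to `X` is confluent. -/
def ConfluentOn (r : A → A → Prop) (X : Set A) : Prop :=
  (∀ a ∈ X, ∀ b, r a b → b ∈ X) ∧ Confluent (fun a b => r a b ∧ a ∈ X ∧ b ∈ X)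

end Confluence

section Sorts

/-- A sort attachment: every function symbol `f` of arity `n` gets a type
`argSort f 0 × ⋯ × argSort f (n - 1) → resSort f`, and every variable gets a sort. -/
structure SortAttachment (L : FirstOrder.Language.{u, v}) (V : Type w) (S : Type z) where
  argSort : ∀ {n : ℕ}, L.Functions n → Fin n → S
  resSort : ∀ {n : ℕ}, L.Functions n → S
  varSort : V → S

variable {L : FirstOrder.Language.{u, v}} {V : Type w} {S : Type z}

/-- The set of variables of sort `α`. -/
def SortAttachment.varsOfSort (𝒮 : SortAttachment L V S) (α : S) : Set V :=
  {x | 𝒮.varSort x = α}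

/-- A term is strictly order-sorted if every variable that occurs in it as an argument of a
function symbol has exactly the sort which that function symbol expects there. -/
def SortAttachment.StrictlySorted (𝒮 : SortAttachment L V S) : L.Term V → Prop
  | .var _ => True
  | .func f ts => ∀ i, (∀ x, ts i = Term.var x → 𝒮.argSort f i = 𝒮.varSort x) ∧
      𝒮.StrictlySorted (ts i)

variable [PartialOrder S]

/-- `𝒮.HasSort t α`: the term `t` is an order-sorted term of sort `α`. An argument may have any
sort below or equal to the sort that the function symbol expects. -/
inductive SortAttachment.HasSort (𝒮 : SortAttachment L V S) : L.Term V → S → Prop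
  | var (x : V) : 𝒮.HasSort (Term.var x) (𝒮.varSort x)
  | func {n : ℕ} (f : L.Functions n) (ts : Fin n → L.Term V) (β : Fin n → S)
      (hts : ∀ i, 𝒮.HasSort (ts i) (β i)) (hβ : ∀ i, β i ≤ 𝒮.argSort f i) :
      𝒮.HasSort (Term.func f ts) (𝒮.resSort f)

/-- The set of all order-sorted terms. -/
def SortAttachment.sortedTerms (𝒮 : SortAttachment L V S) : Set (L.Term V) :=
  {t | ∃ α, 𝒮.HasSort t α}

/-- A TRS is compatible with a sort attachment if both sides of every rule are order-sorted, the
sort of the left-hand side is above or equal to the sort of the right-hand side, and the left-hand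
side is strictly order-sorted. (A term has at most one sort.) -/
def SortAttachment.Compatible (𝒮 : SortAttachment L V S) (R : TRS L V) : Prop :=
  ∀ ρ ∈ R, ∃ α β, 𝒮.HasSort ρ.lhs α ∧ 𝒮.HasSort ρ.rhs β ∧ β ≤ α ∧ 𝒮.StrictlySorted ρ.lhs

end Sorts

end OrderSorted

/-! Call the edge from a function symbol to an argument ill-sorted if the root sort of the argument
is not below the expected sort, and let the rank of a term be the largest number of ill-sorted edges
on a path. Compatibility makes rewriting non-increasing in rank (`StepOver.rankAt_le`), and terms of
rank 0 are order-sorted, hence confluent by hypothesis. The theorem follows by induction on the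
rank.

In a term of rank at most r + 1, move the maximal ill-sorted proper subterms into holes. A hole has
the sort expected at its place and weighs as much as the rank of its content, so the holed term has
rank at most r (`rank_abstractAliens_le`). Holed terms of rank at most r carry three relations:
rewriting with holes as variables, rewriting inside holes (`Inner`), and opening holes (`Expand`).
The induction hypothesis gives confluence of the first (`confluentAt_of_rank_le`) and joins peaks of
the second (`Inner.join`). Left-linearity makes the first commute with the other two
(`Steps.lift_rel`). The remaining peaks close by `Expand.join` and `Expand.commute_inner`, so
`exists_join_of_squares` applies.

Every step of the flattened term must lift to holed terms (`exists_lift_step`). The obstacle is a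
left-hand side that reaches into a hole; order-sortedness shows that the content then fits its
place, and such holes can be opened without raising the rank (`fuse`). -/

namespace OrderSorted

open FirstOrder FirstOrder.Language Relation

/-! ### Substitutions, variables and linear terms -/

section Substitution

variable {L : FirstOrder.Language.{u, v}}

theorem subst_congr {V W : Type*} {σ τ : V → L.Term W} :
    ∀ {t : L.Term V}, (∀ x ∈ vars t, σ x = τ x) → t.subst σ = t.subst τ
  | .var x, h => h x rfl
  | .func _ _, h => by
      simp only [Term.subst]
      congr 1
      funext i
      exact subst_congr fun x hx => h x (Set.mem_iUnion.2 ⟨i, hx⟩)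

theorem subst_subst {U V W : Type*} (σ : U → L.Term V) (τ : V → L.Term W) :
    ∀ t : L.Term U, (t.subst σ).subst τ = t.subst fun x => (σ x).subst τ
  | .var x => rfl
  | .func f ts => by
      simp only [Term.subst]
      congr 1
      funext i
      exact subst_subst σ τ (ts i)

theorem subst_var {V : Type*} : ∀ t : L.Term V, t.subst Term.var = t
  | .var x => rfl
  | .func f ts => by
      simp only [Term.subst]
      congr 1
      funext i
      exact subst_var (ts i)

theorem finite_vars {V : Type*} : ∀ t : L.Term V, (vars t).Finite
  | .var x => Set.finite_singleton x
  | .func _ ts => Set.finite_iUnion fun i => finite_vars (ts i)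

theorem mem_vars_subst {V W : Type*} {σ : V → L.Term W} {y : W} :
    ∀ {t : L.Term V}, y ∈ vars (t.subst σ) ↔ ∃ x ∈ vars t, y ∈ vars (σ x)
  | .var x => by simp [vars, Term.subst]
  | .func f ts => by
      simp only [Term.subst, vars, Set.mem_iUnion, mem_vars_subst]
      constructor
      · rintro ⟨i, x, hx, hy⟩
        exact ⟨x, ⟨i, hx⟩, hy⟩
      · rintro ⟨x, ⟨i, hx⟩, hy⟩
        exact ⟨i, x, hx, hy⟩

theorem one_le_occ {V : Type*} {x : V} : ∀ {t : L.Term V}, x ∈ vars t → 1 ≤ occ x t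
  | .var y, h => by obtain rfl : x = y := h; simp [occ]
  | .func f ts, h => by
      obtain ⟨i, hi⟩ := Set.mem_iUnion.1 h
      exact (one_le_occ hi).trans
        (Finset.single_le_sum (f := fun i => occ x (ts i)) (fun _ _ => Nat.zero_le _)
          (Finset.mem_univ i))

theorem Linear.arg {V : Type*} {n : ℕ} {f : L.Functions n} {ts : Fin n → L.Term V}
    (h : Linear (Term.func f ts)) (i : Fin n) : Linear (ts i) := fun x =>
  (Finset.single_le_sum (f := fun i => occ x (ts i)) (fun _ _ => Nat.zero_le _)
    (Finset.mem_univ i)).trans (h x)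

theorem Linear.index_eq {V : Type*} {n : ℕ} {f : L.Functions n} {ts : Fin n → L.Term V}
    (h : Linear (Term.func f ts)) {x : V} {i j : Fin n} (hi : x ∈ vars (ts i))
    (hj : x ∈ vars (ts j)) : i = j := by
  by_contra hij
  have h1 : ∑ k ∈ {i, j}, occ x (ts k) ≤ ∑ k, occ x (ts k) :=
    Finset.sum_le_sum_of_subset (Finset.subset_univ _)
  rw [Finset.sum_pair hij] at h1
  have h2 : ∑ k, occ x (ts k) ≤ 1 := h x
  have := one_le_occ hi
  have := one_le_occ hj
  omega

end Substitution

/-! ### Occurrence-wise replacement of variables -/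

section Lift

variable {L : FirstOrder.Language.{u, v}}

/-- `Lift B t u`: the term `u` arises from `t` by replacing every occurrence of a variable `x`,
independently of the other occurrences, by some term related to `x` by `B`. -/
def Lift {V W : Type*} (B : V → L.Term W → Prop) : L.Term V → L.Term W → Prop
  | .var x, u => B x u
  | .func f ts, u => ∃ us, u = Term.func f us ∧ ∀ i, Lift B (ts i) (us i)

theorem Lift.subst {V W : Type*} {B : V → L.Term W → Prop} {σ : V → L.Term W} :
    ∀ {t : L.Term V}, (∀ x ∈ vars t, B x (σ x)) → Lift B t (t.subst σ)
  | .var x, h => h x rfl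
  | .func _ _, h =>
      ⟨_, rfl, fun i => Lift.subst fun x hx => h x (Set.mem_iUnion.2 ⟨i, hx⟩)⟩

theorem lift_subst_left {U V W : Type*} {B : V → L.Term W → Prop} {σ : U → L.Term V} :
    ∀ {t : L.Term U} {u : L.Term W},
      Lift B (t.subst σ) u ↔ Lift (fun x => Lift B (σ x)) t u
  | .var x, u => Iff.rfl
  | .func f ts, u => by simp only [Term.subst, Lift, lift_subst_left]

/-- Each variable has a single occurrence, so replacements chosen independently at the occurrences
define a function. This is where left-linearity enters. -/
theorem Lift.exists_subst {V W : Type*} {B : V → L.Term W → Prop} :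
    ∀ {t : L.Term V} {u : L.Term W}, Linear t → Lift B t u →
      ∃ σ : V → L.Term W, u = t.subst σ ∧ ∀ x ∈ vars t, B x (σ x)
  | .var x, u, _, h => ⟨fun _ => u, rfl, fun y hy => by obtain rfl : y = x := hy; exact h⟩
  | .func f ts, u, hl, h => by
      classical
      obtain ⟨us, rfl, hus⟩ := h
      choose σ hσ hB using fun i => Lift.exists_subst (hl.arg i) (hus i)
      -- The chosen index is the only one possible, by linearity; off the variables of the arguments
      -- the value `Term.func f us` is arbitrary.
      have key : ∀ i, ∀ x ∈ vars (ts i),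
          (if h : ∃ j, x ∈ vars (ts j) then σ h.choose x else Term.func f us) = σ i x := by
        intro i x hx
        have h : ∃ j, x ∈ vars (ts j) := ⟨i, hx⟩
        rw [dif_pos h, hl.index_eq h.choose_spec hx]
      refine ⟨fun x => if h : ∃ j, x ∈ vars (ts j) then σ h.choose x else Term.func f us, ?_, ?_⟩
      · simp only [Term.subst]
        congr 1
        funext i
        rw [hσ i]
        exact (subst_congr (key i)).symm
      · intro x hx
        obtain ⟨i, hi⟩ := Set.mem_iUnion.1 hx
        simp only [key i x hi]
        exact hB i x hi

end Lift

/-! ### Rewriting over an arbitrary set of variables -/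

section Steps

variable {L : FirstOrder.Language.{u, v}} {V : Type w} {W : Type*}

/-- The rewrite relation of a system with rules over `V` on the terms over another set `W` of
variables. -/
inductive StepOver (R : TRS L V) : L.Term W → L.Term W → Prop
  | root (ρ : Rule L V) (hρ : ρ ∈ R) (σ : V → L.Term W) :
      StepOver R (ρ.lhs.subst σ) (ρ.rhs.subst σ)
  | arg {n : ℕ} (f : L.Functions n) (ts : Fin n → L.Term W) (i : Fin n) (u : L.Term W)
      (h : StepOver R (ts i) u) :
      StepOver R (Term.func f ts) (Term.func f (Function.update ts i u))

theorem stepOver_iff {R : TRS L V} {t u : L.Term V} : StepOver R t u ↔ Step R t u := by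
  constructor
  · intro h
    induction h with
    | root ρ hρ σ => exact .root ρ hρ σ
    | arg f ts i u _ ih => exact .arg f ts i u ih
  · intro h
    induction h with
    | root ρ hρ σ => exact .root ρ hρ σ
    | arg f ts i u _ ih => exact .arg f ts i u ih

theorem not_stepOver_var {R : TRS L V} {x : W} {u : L.Term W} :
    ¬ StepOver R (Term.var x) u := by
  intro h
  generalize ht : Term.var x = t at h
  cases h with
  | root ρ hρ σ =>
    cases hl : ρ.lhs with
    | var y => exact ρ.lhs_ne_var y hl
    | func f ts => rw [hl] at ht; cases ht
  | arg => cases ht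

theorem subst_update {W' : Type*} {n : ℕ} (τ : W → L.Term W') (ts : Fin n → L.Term W) (i : Fin n)
    (u : L.Term W) : (fun j => (Function.update ts i u j).subst τ) =
      Function.update (fun j => (ts j).subst τ) i (u.subst τ) := by
  funext j
  rcases eq_or_ne j i with rfl | hj
  · simp
  · simp [hj]

theorem StepOver.subst {W' : Type*} {R : TRS L V} {t u : L.Term W} (h : StepOver R t u)
    (τ : W → L.Term W') : StepOver R (t.subst τ) (u.subst τ) := by
  induction h with
  | root ρ hρ σ =>
    rw [subst_subst, subst_subst]
    exact .root ρ hρ _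
  | arg f ts i u _ ih =>
    simp only [Term.subst]
    rw [subst_update]
    exact .arg f _ i _ ih

theorem StepOver.vars_subset {R : TRS L V} {t u : L.Term W} (h : StepOver R t u) :
    vars u ⊆ vars t := by
  induction h with
  | root ρ hρ σ =>
    intro y hy
    obtain ⟨x, hx, hy⟩ := mem_vars_subst.1 hy
    exact mem_vars_subst.2 ⟨x, ρ.vars_rhs_subset hx, hy⟩
  | arg f ts i u _ ih =>
    refine Set.iUnion_subset fun j => ?_
    rcases eq_or_ne j i with rfl | hj
    · rw [Function.update_self]
      exact ih.trans (Set.subset_iUnion (fun j => vars (ts j)) j)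
    · rw [Function.update_of_ne hj]
      exact Set.subset_iUnion (fun j => vars (ts j)) j

/-- Many-step reduction on the terms over `W`. -/
abbrev Steps (R : TRS L V) : L.Term W → L.Term W → Prop := ReflTransGen (StepOver R)

theorem steps_iff {R : TRS L V} {t u : L.Term V} : Steps R t u ↔ ReflTransGen (Step R) t u := by
  have : StepOver R = Step R (L := L) (V := V) := by
    funext t u
    exact propext stepOver_iff
  rw [Steps, this]

theorem Steps.subst {W' : Type*} {R : TRS L V} {t u : L.Term W} (h : Steps R t u)
    (τ : W → L.Term W') : Steps R (t.subst τ) (u.subst τ) :=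
  h.lift (fun t => t.subst τ) fun _ _ h => h.subst τ

theorem Steps.vars_subset {R : TRS L V} {t u : L.Term W} (h : Steps R t u) :
    vars u ⊆ vars t := by
  induction h with
  | refl => exact subset_rfl
  | tail _ h ih => exact h.vars_subset.trans ih

theorem Steps.update {R : TRS L V} {n : ℕ} (f : L.Functions n) (ts : Fin n → L.Term W) (i : Fin n)
    {t u : L.Term W} (h : Steps R t u) :
    Steps R (Term.func f (Function.update ts i t)) (Term.func f (Function.update ts i u)) := by
  refine h.lift (fun t => Term.func f (Function.update ts i t)) fun a b h => ?_
  have := StepOver.arg f (Function.update ts i a) i b (by simpa using h)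
  simpa using this

theorem Steps.func {R : TRS L V} {n : ℕ} (f : L.Functions n) {ts us : Fin n → L.Term W}
    (h : ∀ i, Steps R (ts i) (us i)) : Steps R (Term.func f ts) (Term.func f us) := by
  classical
  have key : ∀ s : Finset (Fin n), Steps R (Term.func f ts) (Term.func f (s.piecewise us ts)) := by
    intro s
    induction s using Finset.induction_on with
    | empty => simpa using ReflTransGen.refl
    | insert i s hi ih =>
      rw [Finset.piecewise_insert]
      refine ih.trans ?_
      have := Steps.update f (s.piecewise us ts) i (h i)
      rwa [← Finset.piecewise_eq_of_notMem s us ts hi, Function.update_eq_self] at this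
  simpa using key Finset.univ

/-- Left-linear systems: steps commute with occurrence-wise replacement of variables. -/
theorem StepOver.lift {W' : Type*} {R : TRS L V} (hll : LeftLinear R)
    {B : W → L.Term W' → Prop} {t u : L.Term W} (h : StepOver R t u) :
    ∀ {t' : L.Term W'}, Lift B t t' → ∃ u', StepOver R t' u' ∧ Lift B u u' := by
  induction h with
  | root ρ hρ σ =>
    intro t' ht
    obtain ⟨τ, rfl, hτ⟩ := (lift_subst_left.1 ht).exists_subst (hll ρ hρ)
    exact ⟨_, .root ρ hρ τ,
      lift_subst_left.2 (Lift.subst fun x hx => hτ x (ρ.vars_rhs_subset hx))⟩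
  | arg f ts i u _ ih =>
    rintro _ ⟨us, rfl, hus⟩
    obtain ⟨u', h1, h2⟩ := ih (hus i)
    refine ⟨_, .arg f us i u' h1, _, rfl, fun j => ?_⟩
    rcases eq_or_ne j i with rfl | hj
    · simpa using h2
    · simpa [hj] using hus j

theorem Steps.lift_rel {W' : Type*} {R : TRS L V} (hll : LeftLinear R)
    {B : W → L.Term W' → Prop} {t u : L.Term W} (h : Steps R t u) {t' : L.Term W'}
    (ht : Lift B t t') : ∃ u', Steps R t' u' ∧ Lift B u u' := by
  induction h with
  | refl => exact ⟨t', .refl, ht⟩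
  | tail _ h ih =>
    obtain ⟨u', h1, h2⟩ := ih
    obtain ⟨u'', h3, h4⟩ := h.lift hll h2
    exact ⟨u'', h1.tail h3, h4⟩

end Steps

/-! ### Rank and its behaviour under rewriting -/

section Rank

variable {L : FirstOrder.Language.{u, v}} {V : Type w} {S : Type z} {W : Type*}

/-- The sort of the root symbol, where `ω` gives the sorts of the variables. -/
def topSort (𝒮 : SortAttachment L V S) (ω : W → S) : L.Term W → S
  | .var x => ω x
  | .func f _ => 𝒮.resSort f

variable [PartialOrder S]

open Classical in
/-- The largest number of ill-sorted edges on a path from the root to a leaf; a variable `x` counts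
as a term of rank `wt x`. -/
noncomputable def rank (𝒮 : SortAttachment L V S) (ω : W → S) (wt : W → ℕ) : L.Term W → ℕ
  | .var x => wt x
  | .func f ts => Finset.univ.sup fun i =>
      rank 𝒮 ω wt (ts i) + if topSort 𝒮 ω (ts i) ≤ 𝒮.argSort f i then 0 else 1

open Classical in
/-- The rank of a term below an edge where the sort `γ` is expected. -/
noncomputable def rankAt (𝒮 : SortAttachment L V S) (ω : W → S) (wt : W → ℕ) (γ : S)
    (t : L.Term W) : ℕ :=
  rank 𝒮 ω wt t + if topSort 𝒮 ω t ≤ γ then 0 else 1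

variable {𝒮 : SortAttachment L V S} {ω : W → S} {wt : W → ℕ}

theorem rankAt_arg_le {n : ℕ} (f : L.Functions n) (ts : Fin n → L.Term W) (i : Fin n) :
    rankAt 𝒮 ω wt (𝒮.argSort f i) (ts i) ≤ rank 𝒮 ω wt (Term.func f ts) :=
  Finset.le_sup (f := fun i => rankAt 𝒮 ω wt (𝒮.argSort f i) (ts i)) (Finset.mem_univ i)

theorem rank_le_rankAt (γ : S) (t : L.Term W) : rank 𝒮 ω wt t ≤ rankAt 𝒮 ω wt γ t :=
  Nat.le_add_right _ _

theorem rankAt_of_le {γ : S} {t : L.Term W} (h : topSort 𝒮 ω t ≤ γ) :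
    rankAt 𝒮 ω wt γ t = rank 𝒮 ω wt t := by
  simp [rankAt, h]

theorem rankAt_of_not_le {γ : S} {t : L.Term W} (h : ¬ topSort 𝒮 ω t ≤ γ) :
    rankAt 𝒮 ω wt γ t = rank 𝒮 ω wt t + 1 := by
  simp [rankAt, h]

theorem rankAt_anti {γ δ : S} (h : γ ≤ δ) (t : L.Term W) :
    rankAt 𝒮 ω wt δ t ≤ rankAt 𝒮 ω wt γ t := by
  by_cases h1 : topSort 𝒮 ω t ≤ γ
  · rw [rankAt_of_le h1, rankAt_of_le (h1.trans h)]
  · rw [rankAt_of_not_le h1]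
    by_cases h2 : topSort 𝒮 ω t ≤ δ
    · rw [rankAt_of_le h2]; omega
    · rw [rankAt_of_not_le h2]

/-- When the expected sort is the root sort of `t`, the edge above `t` costs nothing. -/
theorem rank_le_of_rankAt_le {t u : L.Term W}
    (h : ∀ γ, rankAt 𝒮 ω wt γ u ≤ rankAt 𝒮 ω wt γ t) : rank 𝒮 ω wt u ≤ rank 𝒮 ω wt t := by
  have := h (topSort 𝒮 ω t)
  rw [rankAt_of_le (le_refl (topSort 𝒮 ω t))] at this
  exact (rank_le_rankAt _ _).trans this

theorem rankAt_func_mono {n : ℕ} (f : L.Functions n) {ts us : Fin n → L.Term W}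
    (h : ∀ i, rankAt 𝒮 ω wt (𝒮.argSort f i) (us i) ≤ rankAt 𝒮 ω wt (𝒮.argSort f i) (ts i))
    (γ : S) :
    rankAt 𝒮 ω wt γ (Term.func f us) ≤ rankAt 𝒮 ω wt γ (Term.func f ts) :=
  Nat.add_le_add_right (Finset.sup_mono_fun fun i _ => h i) _

theorem rankAt_update_le {n : ℕ} (f : L.Functions n) {ts : Fin n → L.Term W} {i : Fin n}
    {u : L.Term W} (h : ∀ γ, rankAt 𝒮 ω wt γ u ≤ rankAt 𝒮 ω wt γ (ts i)) (γ : S) :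
    rankAt 𝒮 ω wt γ (Term.func f (Function.update ts i u)) ≤
      rankAt 𝒮 ω wt γ (Term.func f ts) := by
  refine rankAt_func_mono f (fun j => ?_) γ
  rcases eq_or_ne j i with rfl | hj
  · simpa using h _
  · simp [hj]

/-- Inside an order-sorted term no edge costs anything, and an edge into a variable expects at least
the sort of that variable, so only the substituted terms contribute. -/
theorem rankAt_subst_le {u : L.Term V} {β : S} (hu : 𝒮.HasSort u β) {σ : V → L.Term W} {N : ℕ}
    (h : ∀ x ∈ vars u, rankAt 𝒮 ω wt (𝒮.varSort x) (σ x) ≤ N) :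
    rankAt 𝒮 ω wt β (u.subst σ) ≤ N := by
  induction hu with
  | var x => exact h x rfl
  | func f ts β hts hβ ih =>
    have : topSort 𝒮 ω ((Term.func f ts).subst σ) ≤ 𝒮.resSort f := le_refl (𝒮.resSort f)
    rw [rankAt_of_le this]
    refine Finset.sup_le fun i _ => ?_
    exact (rankAt_anti (hβ i) _).trans (ih i fun x hx => h x (Set.mem_iUnion.2 ⟨i, hx⟩))

/-- Strictness matters here: the edge into a variable expects exactly its sort, so the cost of an
ill-sorted substituted term is counted in full. Without strictness the edge could expect a larger
sort and hide that cost. -/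
theorem le_rank_subst {σ : V → L.Term W} {x : V} : ∀ {u : L.Term V}, 𝒮.StrictlySorted u →
    (∀ y, u ≠ Term.var y) → x ∈ vars u →
      rankAt 𝒮 ω wt (𝒮.varSort x) (σ x) ≤ rank 𝒮 ω wt (u.subst σ)
  | .var y, _, h, _ => (h y rfl).elim
  | .func f ts, hs, _, hx => by
      obtain ⟨i, hi⟩ := Set.mem_iUnion.1 hx
      obtain ⟨h1, h2⟩ := hs i
      refine le_trans ?_ (rankAt_arg_le f (fun i => (ts i).subst σ) i)
      by_cases hv : ∃ y, ts i = Term.var y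
      · obtain ⟨y, hy⟩ := hv
        rw [hy] at hi
        obtain rfl : x = y := hi
        rw [h1 x hy, hy]
        rfl
      · push Not at hv
        exact (le_rank_subst h2 hv hi).trans (rank_le_rankAt _ _)

theorem topSort_subst {u : L.Term V} {α : S} (h : 𝒮.HasSort u α) (hu : ∀ x, u ≠ Term.var x)
    (σ : V → L.Term W) : topSort 𝒮 ω (u.subst σ) = α := by
  cases h with
  | var x => exact (hu x rfl).elim
  | func => rfl

/-- A step may change the root sort, so a bound on `rank` alone would not pass through contexts; the
bound for every expected sort does. A collapsing step can expose an ill-sorted edge at the root, but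
that edge was already counted inside the left-hand side. -/
theorem StepOver.rankAt_le {R : TRS L V} (hR : 𝒮.Compatible R) {t u : L.Term W}
    (h : StepOver R t u) : ∀ γ, rankAt 𝒮 ω wt γ u ≤ rankAt 𝒮 ω wt γ t := by
  induction h with
  | root ρ hρ σ =>
    intro γ
    obtain ⟨α, β, hl, hr, hβα, hs⟩ := hR ρ hρ
    have key : rankAt 𝒮 ω wt β (ρ.rhs.subst σ) ≤ rank 𝒮 ω wt (ρ.lhs.subst σ) :=
      rankAt_subst_le hr fun x hx => le_rank_subst hs ρ.lhs_ne_var (ρ.vars_rhs_subset hx)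
    have htop : topSort 𝒮 ω (ρ.lhs.subst σ) = α := topSort_subst hl ρ.lhs_ne_var σ
    by_cases hγ : α ≤ γ
    · rw [rankAt_of_le (htop.le.trans hγ)]
      exact (rankAt_anti (hβα.trans hγ) _).trans key
    -- The edge above the redex is already ill-sorted, which leaves room for an ill-sorted edge
    -- above the contractum.
    · rw [rankAt_of_not_le (t := ρ.lhs.subst σ) (by rwa [htop])]
      have h1 : rankAt 𝒮 ω wt γ (ρ.rhs.subst σ) ≤ rank 𝒮 ω wt (ρ.rhs.subst σ) + 1 := by
        unfold rankAt
        split_ifs <;> omega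
      have h2 := (rank_le_rankAt β (ρ.rhs.subst σ)).trans key
      omega
  | arg f ts i u _ ih => exact rankAt_update_le f ih

theorem Steps.rankAt_le {R : TRS L V} (hR : 𝒮.Compatible R) {t u : L.Term W}
    (h : Steps R t u) (γ : S) : rankAt 𝒮 ω wt γ u ≤ rankAt 𝒮 ω wt γ t := by
  induction h with
  | refl => exact le_rfl
  | tail _ h ih => exact (h.rankAt_le hR γ).trans ih

theorem Steps.rank_le {R : TRS L V} (hR : 𝒮.Compatible R) {t u : L.Term W}
    (h : Steps R t u) : rank 𝒮 ω wt u ≤ rank 𝒮 ω wt t :=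
  rank_le_of_rankAt_le (h.rankAt_le hR)

theorem hasSort_of_rank_eq_zero : ∀ {t : L.Term V}, rank 𝒮 𝒮.varSort (fun _ => 0) t = 0 →
    𝒮.HasSort t (topSort 𝒮 𝒮.varSort t)
  | .var x, _ => .var x
  | .func f ts, h => by
      have h0 : ∀ i, rankAt 𝒮 𝒮.varSort (fun _ => 0) (𝒮.argSort f i) (ts i) = 0 := fun i =>
        Nat.le_zero.1 ((rankAt_arg_le f ts i).trans h.le)
      refine .func f ts _ (fun i => hasSort_of_rank_eq_zero
        (Nat.le_zero.1 ((rank_le_rankAt _ _).trans (h0 i).le))) fun i => ?_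
      by_contra hi
      have := h0 i
      rw [rankAt_of_not_le hi] at this
      omega

end Rank

/-! ### Transfer of confluence along sort-preserving renamings -/

section Renaming

variable {L : FirstOrder.Language.{u, v}} {V : Type w} {S : Type z} {W : Type*}

/-- Any two reducts of a term have a common reduct. -/
def ConfluentAt (R : TRS L V) (t : L.Term W) : Prop :=
  ∀ u v, Steps R t u → Steps R t v → ∃ d, Steps R u d ∧ Steps R v d

theorem topSort_rename {𝒮 : SortAttachment L V S} {ω : W → S} {e : W → V}
    (he : ∀ x, 𝒮.varSort (e x) = ω x) :
    ∀ t : L.Term W, topSort 𝒮 𝒮.varSort (t.subst fun x => Term.var (e x)) = topSort 𝒮 ω t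
  | .var x => he x
  | .func _ _ => rfl

theorem exists_rename {𝒮 : SortAttachment L V S} (hV : ∀ α : S, (𝒮.varsOfSort α).Infinite)
    (ω : W → S) {F : Set W} (hF : F.Finite) :
    ∃ e : W → V, (∀ x, 𝒮.varSort (e x) = ω x) ∧ Set.InjOn e F := by
  classical
  induction F, hF using Set.Finite.induction_on with
  | empty =>
    choose e he using fun x => (hV (ω x)).nonempty
    exact ⟨e, he, Set.injOn_empty e⟩
  | @insert a s ha hs ih =>
    obtain ⟨e, he, hinj⟩ := ih
    obtain ⟨v, hv, hvs⟩ := ((hV (ω a)).sdiff (hs.image e)).nonempty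
    refine ⟨Function.update e a v, fun x => ?_, ?_⟩
    · rcases eq_or_ne x a with rfl | hx
      · rw [Function.update_self]
        exact hv
      · simpa [hx] using he x
    · have heq : Set.EqOn e (Function.update e a v) s := fun x hx =>
        (Function.update_of_ne (ne_of_mem_of_not_mem hx ha) v e).symm
      refine (Set.injOn_insert ha).2 ⟨hinj.congr heq, ?_⟩
      rw [Function.update_self, ← heq.image_eq]
      exact hvs

variable [PartialOrder S]

theorem rank_rename_le {𝒮 : SortAttachment L V S} {ω : W → S} (wt : W → ℕ) {e : W → V}
    (he : ∀ x, 𝒮.varSort (e x) = ω x) :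
    ∀ t : L.Term W,
      rank 𝒮 𝒮.varSort (fun _ => 0) (t.subst fun x => Term.var (e x)) ≤ rank 𝒮 ω wt t
  | .var x => Nat.zero_le _
  | .func f ts => by
      refine Finset.sup_mono_fun fun i _ => ?_
      rw [topSort_rename he]
      exact Nat.add_le_add_right (rank_rename_le wt he (ts i)) _

/-- This carries the induction hypothesis over to terms with holes. Only the finitely many variables
of `t` matter, and each sort has enough variables to rename them injectively; renaming back returns
the joining reductions. -/
theorem confluentAt_of_rank_le {𝒮 : SortAttachment L V S}
    (hV : ∀ α : S, (𝒮.varsOfSort α).Infinite) {R : TRS L V} {r : ℕ}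
    (hr : ∀ t : L.Term V, rank 𝒮 𝒮.varSort (fun _ => 0) t ≤ r → ConfluentAt R t)
    (ω : W → S) (wt : W → ℕ) {t : L.Term W} (ht : rank 𝒮 ω wt t ≤ r) : ConfluentAt R t := by
  classical
  intro u v hu hv
  obtain ⟨e, he, hinj⟩ := exists_rename hV ω (finite_vars t)
  obtain ⟨d, hud, hvd⟩ := hr _ ((rank_rename_le wt he t).trans ht) _ _
    (hu.subst fun x => Term.var (e x)) (hv.subst fun x => Term.var (e x))
  -- A left inverse of the renaming on the variables of `t`; the default value `t` is arbitrary.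
  let g : V → L.Term W := fun y =>
    if h : ∃ x ∈ vars t, e x = y then Term.var h.choose else t
  have hg : ∀ x ∈ vars t, g (e x) = Term.var x := by
    intro x hx
    have h : ∃ x' ∈ vars t, e x' = e x := ⟨x, hx, rfl⟩
    simp only [g]
    rw [dif_pos h, hinj h.choose_spec.1 hx h.choose_spec.2]
  have hback : ∀ s : L.Term W, vars s ⊆ vars t →
      (s.subst fun x => Term.var (e x)).subst g = s := by
    intro s hs
    rw [subst_subst]
    refine Eq.trans (subst_congr fun x hx => ?_) (subst_var s)
    exact hg x (hs hx)
  refine ⟨d.subst g, ?_, ?_⟩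
  · have := hud.subst g
    rwa [hback u hu.vars_subset] at this
  · have := hvd.subst g
    rwa [hback v hv.vars_subset] at this

end Renaming

/-! ### Confluence from commuting squares -/

section Abstract

variable {A : Type*}

/-- If `s` is confluent, commutes with `p`, and peaks of `p` can be closed by `p` followed by `s`,
then the union of the two relations is confluent. -/
theorem exists_join_of_squares {p s : A → A → Prop}
    (hst : ∀ {a b c}, s a b → s b c → s a c)
    (hss : ∀ {a b c}, s a b → s a c → ∃ d, s b d ∧ s c d)
    (hsp : ∀ {a b c}, s a b → p a c → ∃ d, p b d ∧ s c d)
    (hpp : ∀ {a b c}, p a b → p a c → ∃ d, Comp p s b d ∧ Comp p s c d)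
    {a b c : A} (hb : ReflTransGen (Comp p s) a b) (hc : ReflTransGen (Comp p s) a c) :
    ∃ d, ReflTransGen (Comp p s) b d ∧ ReflTransGen (Comp p s) c d := by
  have strip : ∀ {a b d}, s a b → Comp p s a d → ∃ e, Comp p s b e ∧ s d e := by
    rintro a b d hab ⟨m, ham, hmd⟩
    obtain ⟨k, hbk, hmk⟩ := hsp hab ham
    obtain ⟨e, hke, hde⟩ := hss hmk hmd
    exact ⟨e, ⟨k, hbk, hke⟩, hde⟩
  refine church_rosser (r := Comp p s) ?_ hb hc
  rintro a b c ⟨a₁, ha₁, hb⟩ ⟨a₂, ha₂, hc⟩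
  obtain ⟨d, h₁, h₂⟩ := hpp ha₁ ha₂
  obtain ⟨d₁, ⟨m₁, hm₁, hk₁⟩, hd₁⟩ := strip hb h₁
  obtain ⟨d₂, ⟨m₂, hm₂, hk₂⟩, hd₂⟩ := strip hc h₂
  obtain ⟨e, he₁, he₂⟩ := hss hd₁ hd₂
  exact ⟨e, .single ⟨m₁, hm₁, hst hk₁ he₁⟩, .single ⟨m₂, hm₂, hst hk₂ he₂⟩⟩

end Abstract

/-! ### Terms with holes -/

section Holes

variable {L : FirstOrder.Language.{u, v}} {V : Type w} {S : Type z}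

variable (L V S) in
/-- Variables together with holes; a hole has a sort and is filled with a term. -/
abbrev Holed := V ⊕ S × L.Term V

/-- The sort of a variable or hole. -/
def holedSort (𝒮 : SortAttachment L V S) : Holed L V S → S :=
  Sum.elim 𝒮.varSort Prod.fst

/-- Put the contents of the holes in place. -/
def flatten (t : L.Term (Holed L V S)) : L.Term V :=
  t.subst (Sum.elim Term.var Prod.snd)

/-- A term regarded as a term without holes. -/
def embed (t : L.Term V) : L.Term (Holed L V S) :=
  t.subst fun x => Term.var (Sum.inl x)

theorem topSort_embed {𝒮 : SortAttachment L V S} : ∀ t : L.Term V,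
    topSort 𝒮 (holedSort 𝒮) (embed t) = topSort 𝒮 𝒮.varSort t
  | .var _ => rfl
  | .func _ _ => rfl

theorem flatten_embed (t : L.Term V) : flatten (embed t : L.Term (Holed L V S)) = t := by
  rw [flatten, embed, subst_subst]
  exact subst_var t

/-- Reduction of the contents of the holes. -/
def Inner (R : TRS L V) : L.Term (Holed L V S) → L.Term (Holed L V S) → Prop :=
  Lift fun x u => match x with
    | .inl x => u = Term.var (.inl x)
    | .inr (γ, a) => ∃ b, Steps R a b ∧ u = Term.var (.inr (γ, b))

/-- Some of the holes are replaced by their contents. -/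
def Expand : L.Term (Holed L V S) → L.Term (Holed L V S) → Prop :=
  Lift fun x u => match x with
    | .inl x => u = Term.var (.inl x)
    | .inr (γ, a) => u = Term.var (.inr (γ, a)) ∨ u = embed a

theorem Inner.refl (R : TRS L V) : ∀ t : L.Term (Holed L V S), Inner R t t
  | .var (.inl _) => rfl
  | .var (.inr (_, a)) => ⟨a, .refl, rfl⟩
  | .func _ _ => ⟨_, rfl, fun _ => Inner.refl R _⟩

theorem Expand.refl : ∀ t : L.Term (Holed L V S), Expand t t
  | .var (.inl _) => rfl
  | .var (.inr (_, _)) => Or.inl rfl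
  | .func _ _ => ⟨_, rfl, fun _ => Expand.refl _⟩

theorem Inner.flatten {R : TRS L V} : ∀ {t u : L.Term (Holed L V S)}, Inner R t u →
    Steps R (flatten t) (flatten u)
  | .var (.inl _), _, h => by cases h; exact .refl
  | .var (.inr (_, _)), _, h => by obtain ⟨b, hb, rfl⟩ := h; exact hb
  | .func f _, _, h => by
      obtain ⟨us, rfl, hus⟩ := h
      exact Steps.func f fun i => Inner.flatten (hus i)

theorem Expand.flatten : ∀ {t u : L.Term (Holed L V S)}, Expand t u →
    flatten u = OrderSorted.flatten t
  | .var (.inl _), _, h => by cases h; rfl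
  | .var (.inr (_, a)), _, h => by
      rcases h with rfl | rfl
      · rfl
      · exact flatten_embed a
  | .func f _, _, h => by
      obtain ⟨us, rfl, hus⟩ := h
      simp only [OrderSorted.flatten, Term.subst]
      congr 1
      funext i
      exact Expand.flatten (hus i)

/-- In a hole that stays closed the reduction remains inner; in an opened hole it becomes ordinary
rewriting of the embedded content. Performing the inner part first gives the shape `Comp p s` used
later. -/
theorem Expand.commute_inner {R : TRS L V} : ∀ {t u v : L.Term (Holed L V S)}, Expand t u →
    Inner R t v → ∃ c d, Inner R u c ∧ Steps R c d ∧ Expand v d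
  | .var (.inl x), _, _, hu, hv => by
      cases hu
      cases hv
      exact ⟨_, _, rfl, .refl, rfl⟩
  | .var (.inr (γ, a)), _, _, hu, hv => by
      obtain ⟨b, hb, rfl⟩ := hv
      rcases hu with rfl | rfl
      · exact ⟨_, _, ⟨b, hb, rfl⟩, .refl, Expand.refl _⟩
      · exact ⟨_, _, Inner.refl R _, hb.subst _, Or.inr rfl⟩
  | .func f _, _, _, hu, hv => by
      obtain ⟨us, rfl, hus⟩ := hu
      obtain ⟨vs, rfl, hvs⟩ := hv
      choose cs ds h1 h2 h3 using fun i => Expand.commute_inner (hus i) (hvs i)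
      exact ⟨_, _, ⟨cs, rfl, h1⟩, Steps.func f h2, ds, rfl, h3⟩

variable [PartialOrder S]

/-- The rank of a term over the variables of the sort attachment. -/
noncomputable abbrev plainRank (𝒮 : SortAttachment L V S) (t : L.Term V) : ℕ :=
  rank 𝒮 𝒮.varSort (fun _ => 0) t

/-- The weight of a hole is the rank of its content. -/
noncomputable def holedWeight (𝒮 : SortAttachment L V S) : Holed L V S → ℕ :=
  Sum.elim (fun _ => 0) fun p => plainRank 𝒮 p.2

/-- The rank of a term with holes. -/
noncomputable abbrev holedRank (𝒮 : SortAttachment L V S) (t : L.Term (Holed L V S)) : ℕ :=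
  rank 𝒮 (holedSort 𝒮) (holedWeight 𝒮) t

/-- The rank of a term with holes below an edge where a sort is expected. -/
noncomputable abbrev holedRankAt (𝒮 : SortAttachment L V S) (γ : S)
    (t : L.Term (Holed L V S)) : ℕ :=
  rankAt 𝒮 (holedSort 𝒮) (holedWeight 𝒮) γ t

variable {𝒮 : SortAttachment L V S}

theorem holedRank_embed : ∀ t : L.Term V, holedRank 𝒮 (embed t) = plainRank 𝒮 t
  | .var _ => rfl
  | .func f ts => by
      refine congrArg (Finset.sup Finset.univ) (funext fun i => ?_)
      have h1 : rank 𝒮 (holedSort 𝒮) (holedWeight 𝒮) (embed (ts i)) =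
        rank 𝒮 𝒮.varSort (fun _ => 0) (ts i) := holedRank_embed (ts i)
      have h2 := topSort_embed (𝒮 := 𝒮) (ts i)
      simp only [embed] at h1 h2
      rw [h1, h2]

theorem Inner.rankAt_le {R : TRS L V} (hR : 𝒮.Compatible R) :
    ∀ {t u : L.Term (Holed L V S)}, Inner R t u → ∀ γ, holedRankAt 𝒮 γ u ≤ holedRankAt 𝒮 γ t
  | .var (.inl _), _, h, γ => by cases h; exact le_rfl
  | .var (.inr (_, a)), _, h, γ => by
      obtain ⟨b, hb, rfl⟩ := h
      exact Nat.add_le_add_right (hb.rank_le hR) _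
  | .func f _, _, h, γ => by
      obtain ⟨us, rfl, hus⟩ := h
      exact rankAt_func_mono f (fun i => Inner.rankAt_le hR (hus i) _) γ

/-- The weight of a hole is the rank of its content, so every content has rank at most `r` and is
confluent by assumption. -/
theorem Inner.join {R : TRS L V} {r : ℕ} (hr : ∀ t, plainRank 𝒮 t ≤ r → ConfluentAt R t) :
    ∀ {t u v : L.Term (Holed L V S)}, holedRank 𝒮 t ≤ r → Inner R t u → Inner R t v →
      ∃ d, Inner R u d ∧ Inner R v d
  | .var (.inl _), _, _, _, hu, hv => by
      cases hu
      cases hv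
      exact ⟨_, rfl, rfl⟩
  | .var (.inr (γ, a)), _, _, ht, hu, hv => by
      obtain ⟨b, hb, rfl⟩ := hu
      obtain ⟨c, hc, rfl⟩ := hv
      obtain ⟨d, hbd, hcd⟩ := hr a ht b c hb hc
      exact ⟨Term.var (.inr (γ, d)), ⟨d, hbd, rfl⟩, ⟨d, hcd, rfl⟩⟩
  | .func f ts, _, _, ht, hu, hv => by
      obtain ⟨us, rfl, hus⟩ := hu
      obtain ⟨vs, rfl, hvs⟩ := hv
      choose ds h1 h2 using fun i => Inner.join hr
        (((rank_le_rankAt _ _).trans (rankAt_arg_le f ts i)).trans ht) (hus i) (hvs i)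
      exact ⟨Term.func f ds, ⟨ds, rfl, h1⟩, ⟨ds, rfl, h2⟩⟩

/-- The join opens the holes opened on either side. Opening a hole may raise the rank, but each hole
of `t` ends up as it is in `u` or in `v`, so no path costs more than in one of the two. -/
theorem Expand.join : ∀ {t u v : L.Term (Holed L V S)}, Expand t u → Expand t v →
    ∃ d, Expand u d ∧ Expand v d ∧ holedRank 𝒮 d ≤ max (holedRank 𝒮 u) (holedRank 𝒮 v) ∧
      ∀ γ, holedRankAt 𝒮 γ d ≤ max (holedRankAt 𝒮 γ u) (holedRankAt 𝒮 γ v)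
  | .var (.inl _), _, _, hu, hv => by
      cases hu
      cases hv
      exact ⟨_, rfl, rfl, le_max_left _ _, fun γ => le_max_left _ _⟩
  | .var (.inr (γ, a)), _, _, hu, hv => by
      rcases hu with rfl | rfl
      · exact ⟨_, hv, Expand.refl _, le_max_right _ _, fun γ => le_max_right _ _⟩
      · rcases hv with rfl | rfl
        · exact ⟨_, Expand.refl _, Or.inr rfl, le_max_left _ _, fun γ => le_max_left _ _⟩
        · exact ⟨_, Expand.refl _, Expand.refl _, le_max_left _ _, fun γ => le_max_left _ _⟩
  | .func f ts, _, _, hu, hv => by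
      obtain ⟨us, rfl, hus⟩ := hu
      obtain ⟨vs, rfl, hvs⟩ := hv
      choose ds h1 h2 _ h3 using fun i => Expand.join (hus i) (hvs i)
      have key : holedRank 𝒮 (Term.func f ds) ≤
          max (holedRank 𝒮 (Term.func f us)) (holedRank 𝒮 (Term.func f vs)) :=
        Finset.sup_le fun i _ => (h3 i _).trans
          (max_le_max (rankAt_arg_le f us i) (rankAt_arg_le f vs i))
      refine ⟨Term.func f ds, ⟨ds, rfl, h1⟩, ⟨ds, rfl, h2⟩, key, fun γ => ?_⟩
      refine (Nat.add_le_add_right key _).trans ?_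
      rw [← max_add_add_right]
      exact le_rfl

/-! ### Opening holes and lifting steps -/

open Classical in
/-- Replace by its content every hole whose content fits where the hole stands; `γ` is the sort
expected at the root. -/
noncomputable def fuse (𝒮 : SortAttachment L V S) :
    S → L.Term (Holed L V S) → L.Term (Holed L V S)
  | _, .var (.inl x) => .var (.inl x)
  | γ, .var (.inr (δ, a)) =>
      if topSort 𝒮 𝒮.varSort a ≤ γ then embed a else .var (.inr (δ, a))
  | _, .func f ts => .func f fun i => fuse 𝒮 (𝒮.argSort f i) (ts i)

theorem expand_fuse : ∀ (γ : S) (t : L.Term (Holed L V S)), Expand t (fuse 𝒮 γ t)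
  | _, .var (.inl _) => rfl
  | γ, .var (.inr (δ, a)) => by
      rw [fuse]
      split_ifs
      · exact Or.inr rfl
      · exact Or.inl rfl
  | _, .func f ts => ⟨_, by rw [fuse], fun i => expand_fuse _ (ts i)⟩

/-- An opened content has rank equal to the weight of its hole, and because it fits, the edge above
it costs nothing. -/
theorem rankAt_fuse_le : ∀ (γ : S) (t : L.Term (Holed L V S)),
    holedRankAt 𝒮 γ (fuse 𝒮 γ t) ≤ holedRankAt 𝒮 γ t
  | _, .var (.inl _) => by rw [fuse]
  | γ, .var (.inr (δ, a)) => by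
      rw [fuse]
      split_ifs with h
      · rw [holedRankAt, rankAt_of_le (by rwa [topSort_embed])]
        exact (holedRank_embed a).le.trans (Nat.le_add_right (plainRank 𝒮 a) _)
      · exact le_rfl
  | γ, .func f ts => by
      rw [fuse]
      exact rankAt_func_mono f (fun i => rankAt_fuse_le _ (ts i)) γ

/-- A hole met at a function symbol of `u` contains a term with the same root symbol. Since `u` is
order-sorted, that symbol fits the expected sort, so `fuse` has opened the hole. -/
theorem lift_fuse {u : L.Term V} {β : S} (hu : 𝒮.HasSort u β) {σ : V → L.Term V} :
    ∀ {γ : S} {t : L.Term (Holed L V S)}, β ≤ γ → flatten t = u.subst σ →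
      Lift (fun x v => flatten v = σ x) u (fuse 𝒮 γ t) := by
  induction hu with
  | var x =>
    intro γ t _ ht
    exact (expand_fuse γ t).flatten.trans ht
  | func f ts β hts hβ ih =>
    intro γ t hγ ht
    rcases t with (x | ⟨δ, a⟩) | ⟨g, cs⟩
    · cases ht
    · have ha : a = (Term.func f ts).subst σ := ht
      have hfit : topSort 𝒮 𝒮.varSort a ≤ γ := by rw [ha]; exact hγ
      rw [fuse, if_pos hfit, ha, embed, subst_subst]
      exact Lift.subst fun x _ => flatten_embed (σ x)
    · simp only [flatten, Term.subst, Term.func.injEq] at ht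
      obtain ⟨rfl, hfg, hts'⟩ := ht
      cases hfg
      rw [fuse]
      exact ⟨_, rfl, fun i => ih i (hβ i) (congrFun (eq_of_heq hts') i)⟩

/-- After fusing some holes, every step lifts to terms with holes. -/
theorem exists_lift_step {R : TRS L V} (hR : 𝒮.Compatible R) (hll : LeftLinear R) :
    ∀ {t : L.Term (Holed L V S)} {u : L.Term V}, StepOver R (flatten t) u →
      ∃ t' u', Expand t t' ∧ (∀ γ, holedRankAt 𝒮 γ t' ≤ holedRankAt 𝒮 γ t) ∧
        (StepOver R t' u' ∨ Inner R t' u') ∧ flatten u' = u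
  | .var (.inl _), _, h => (not_stepOver_var h).elim
  | .var (.inr (γ, a)), u, h =>
      ⟨_, Term.var (.inr (γ, u)), Expand.refl _, fun _ => le_rfl, Or.inr ⟨u, .single h, rfl⟩, rfl⟩
  | .func f ts, u, h => by
      generalize hs : flatten (Term.func f ts) = s at h
      cases h with
      | root ρ hρ σ =>
        obtain ⟨α, β, hl, hr, hβα, hss⟩ := hR ρ hρ
        obtain ⟨τ, hτ, hτσ⟩ := (lift_fuse hl le_rfl hs).exists_subst (hll ρ hρ)
        refine ⟨_, ρ.rhs.subst τ, expand_fuse (𝒮 := 𝒮) α _, fun γ => ?_, Or.inl ?_, ?_⟩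
        -- At a function symbol `fuse` ignores its sort argument, so fusing at `α` and at `γ` agree.
        · have := rankAt_fuse_le (𝒮 := 𝒮) γ (Term.func f ts)
          rw [fuse] at this ⊢
          exact this
        · rw [hτ]
          exact .root ρ hρ τ
        · rw [flatten, subst_subst]
          exact subst_congr fun x hx => hτσ x (ρ.vars_rhs_subset hx)
      | arg g us i v h =>
        simp only [flatten, Term.subst, Term.func.injEq] at hs
        obtain ⟨rfl, hfg, hus⟩ := hs
        cases hfg
        cases hus
        obtain ⟨t', u', h1, h2, h3, h4⟩ := exists_lift_step hR hll h
        refine ⟨Term.func f (Function.update ts i t'), Term.func f (Function.update ts i u'),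
          ⟨_, rfl, fun j => ?_⟩, rankAt_update_le f h2, ?_, ?_⟩
        · rcases eq_or_ne j i with rfl | hj
          · rw [Function.update_self]
            exact h1
          · rw [Function.update_of_ne hj]
            exact Expand.refl (ts j)
        · rcases h3 with h3 | h3
          · have := StepOver.arg f (Function.update ts i t') i u' (by simpa using h3)
            exact Or.inl (by simpa using this)
          · refine Or.inr ⟨_, rfl, fun j => ?_⟩
            rcases eq_or_ne j i with rfl | hj
            · rw [Function.update_self, Function.update_self]
              exact h3
            · rw [Function.update_of_ne hj, Function.update_of_ne hj]
              exact Inner.refl R (ts j)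
        · simp only [flatten, Term.subst]
          rw [subst_update]
          exact congrArg (fun v => Term.func f (Function.update _ i v)) h4

/-! ### Hiding ill-sorted subterms -/

open Classical in
/-- Turn every maximal ill-sorted proper subterm into a hole. -/
noncomputable def abstractAliens (𝒮 : SortAttachment L V S) : L.Term V → L.Term (Holed L V S)
  | .var x => .var (.inl x)
  | .func f ts => .func f fun i =>
      if topSort 𝒮 𝒮.varSort (ts i) ≤ 𝒮.argSort f i then abstractAliens 𝒮 (ts i)
      else .var (.inr (𝒮.argSort f i, ts i))

theorem flatten_abstractAliens : ∀ t : L.Term V, flatten (abstractAliens 𝒮 t) = t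
  | .var _ => by rw [abstractAliens]; rfl
  | .func f ts => by
      rw [abstractAliens]
      simp only [flatten, Term.subst]
      congr 1
      funext i
      split_ifs
      · exact flatten_abstractAliens (ts i)
      · rfl

theorem topSort_abstractAliens : ∀ t : L.Term V,
    topSort 𝒮 (holedSort 𝒮) (abstractAliens 𝒮 t) = topSort 𝒮 𝒮.varSort t
  | .var _ => by rw [abstractAliens]; rfl
  | .func f ts => by rw [abstractAliens]; rfl

theorem rank_abstractAliens_le {r : ℕ} : ∀ {t : L.Term V}, plainRank 𝒮 t ≤ r + 1 →
    holedRank 𝒮 (abstractAliens 𝒮 t) ≤ r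
  | .var _, _ => by rw [abstractAliens]; exact Nat.zero_le r
  | .func f ts, h => by
      rw [abstractAliens]
      refine Finset.sup_le fun i _ => ?_
      have hi := (rankAt_arg_le f ts i).trans h
      change holedRankAt 𝒮 (𝒮.argSort f i) _ ≤ r
      beta_reduce
      split_ifs with hfit
      · rw [holedRankAt, rankAt_of_le ((topSort_abstractAliens (ts i)).le.trans hfit)]
        exact rank_abstractAliens_le ((rank_le_rankAt _ _).trans hi)
      -- The ill-sorted edge costs one in the term, and nothing once the hole has the expected sort.
      · rw [rankAt_of_not_le hfit] at hi
        rw [holedRankAt, rankAt_of_le (le_refl (𝒮.argSort f i))]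
        exact Nat.le_of_succ_le_succ hi

/-! ### Induction step and base case -/

theorem confluentAt_succ {R : TRS L V} (hV : ∀ α : S, (𝒮.varsOfSort α).Infinite)
    (hR : 𝒮.Compatible R) (hll : LeftLinear R) {r : ℕ}
    (hr : ∀ t, plainRank 𝒮 t ≤ r → ConfluentAt R t) {t : L.Term V}
    (ht : plainRank 𝒮 t ≤ r + 1) : ConfluentAt R t := by
  -- Opening holes can leave the rank bound, so the bound is part of the carrier and each joining
  -- term below must be shown to satisfy it.
  let A := {C : L.Term (Holed L V S) // holedRank 𝒮 C ≤ r}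
  let p : A → A → Prop := fun C D => Inner R C.1 D.1 ∨ Expand C.1 D.1
  let s : A → A → Prop := fun C D => Steps R C.1 D.1
  have hp : ∀ C, p C C := fun C => Or.inl (Inner.refl R C.1)
  have join : ∀ {a b c : A}, ReflTransGen (Comp p s) a b → ReflTransGen (Comp p s) a c →
      ∃ d, ReflTransGen (Comp p s) b d ∧ ReflTransGen (Comp p s) c d := by
    refine exists_join_of_squares (p := p) (s := s) (fun h1 h2 => ReflTransGen.trans h1 h2) ?_ ?_ ?_
    · intro a b c hb hc
      obtain ⟨d, hbd, hcd⟩ := confluentAt_of_rank_le hV hr (holedSort 𝒮) (holedWeight 𝒮) a.2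
        b.1 c.1 hb hc
      exact ⟨⟨d, (hbd.rank_le hR).trans b.2⟩, hbd, hcd⟩
    · rintro a b c hb (hc | hc)
      · obtain ⟨d, hcd, hbd⟩ := Steps.lift_rel hll hb hc
        exact ⟨⟨d, (hcd.rank_le hR).trans c.2⟩, Or.inl hbd, hcd⟩
      · obtain ⟨d, hcd, hbd⟩ := Steps.lift_rel hll hb hc
        exact ⟨⟨d, (hcd.rank_le hR).trans c.2⟩, Or.inr hbd, hcd⟩
    · have mixed : ∀ {a b c : A}, Expand a.1 b.1 → Inner R a.1 c.1 →
          ∃ d, Comp p s b d ∧ Comp p s c d := by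
        intro a b c hb hc
        obtain ⟨m, d, hbm, hmd, hcd⟩ := hb.commute_inner hc
        -- The bound on `d` comes through `m` from `b`, since expanding `c` gives no bound.
        have hm : holedRank 𝒮 m ≤ r := (rank_le_of_rankAt_le (hbm.rankAt_le hR)).trans b.2
        have hd : holedRank 𝒮 d ≤ r := (hmd.rank_le hR).trans hm
        exact ⟨⟨d, hd⟩, ⟨⟨m, hm⟩, Or.inl hbm, hmd⟩, ⟨⟨d, hd⟩, Or.inr hcd, .refl⟩⟩
      rintro a b c (hb | hb) (hc | hc)
      · obtain ⟨d, hbd, hcd⟩ := Inner.join hr a.2 hb hc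
        have hd : holedRank 𝒮 d ≤ r := (rank_le_of_rankAt_le (hbd.rankAt_le hR)).trans b.2
        exact ⟨⟨d, hd⟩, ⟨⟨d, hd⟩, Or.inl hbd, .refl⟩, ⟨⟨d, hd⟩, Or.inl hcd, .refl⟩⟩
      · obtain ⟨d, h1, h2⟩ := mixed hc hb
        exact ⟨d, h2, h1⟩
      · exact mixed hb hc
      · obtain ⟨d, hbd, hcd, hrk, -⟩ := Expand.join (𝒮 := 𝒮) hb hc
        have hd : holedRank 𝒮 d ≤ r := hrk.trans (max_le b.2 c.2)
        exact ⟨⟨d, hd⟩, ⟨⟨d, hd⟩, Or.inr hbd, .refl⟩, ⟨⟨d, hd⟩, Or.inr hcd, .refl⟩⟩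
  have lifts : ∀ {t u : L.Term V}, Steps R t u → ∀ C : A, flatten C.1 = t →
      ∃ D : A, ReflTransGen (Comp p s) C D ∧ flatten D.1 = u := by
    intro t u h
    induction h with
    | refl => exact fun C hC => ⟨C, .refl, hC⟩
    | tail _ h ih =>
      intro C hC
      obtain ⟨D, hCD, rfl⟩ := ih C hC
      obtain ⟨D', E, h1, h2, h3, h4⟩ := exists_lift_step hR hll h
      have hD' : holedRank 𝒮 D' ≤ r := (rank_le_of_rankAt_le h2).trans D.2
      have hE : holedRank 𝒮 E ≤ r := by
        rcases h3 with h3 | h3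
        · exact (rank_le_of_rankAt_le (h3.rankAt_le hR)).trans hD'
        · exact (rank_le_of_rankAt_le (h3.rankAt_le hR)).trans hD'
      -- Opening holes is one composite step with no rewriting after it; the lifted step itself is a
      -- second one.
      refine ⟨⟨E, hE⟩, (hCD.tail ⟨⟨D', hD'⟩, Or.inr h1, .refl⟩).trans ?_, h4⟩
      rcases h3 with h3 | h3
      · exact .single ⟨_, hp _, .single h3⟩
      · exact .single ⟨⟨E, hE⟩, Or.inl h3, .refl⟩
  have sound : ∀ {C D : A}, ReflTransGen (Comp p s) C D →
      Steps R (flatten C.1) (flatten D.1) := by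
    intro C D h
    induction h with
    | refl => exact .refl
    | tail _ h ih =>
      obtain ⟨m, h1, h2⟩ := h
      -- Filling the holes is a substitution, so rewriting around them survives flattening; opening
      -- holes does not change the flattened term.
      refine ih.trans (ReflTransGen.trans ?_ (Steps.subst h2 _))
      rcases h1 with h1 | h1
      · exact h1.flatten
      · rw [← h1.flatten]
        exact .refl
  intro u v hu hv
  let C : A := ⟨abstractAliens 𝒮 t, rank_abstractAliens_le ht⟩
  obtain ⟨D, hD, rfl⟩ := lifts hu C (flatten_abstractAliens t)
  obtain ⟨E, hE, rfl⟩ := lifts hv C (flatten_abstractAliens t)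
  obtain ⟨F, hDF, hEF⟩ := join hD hE
  exact ⟨flatten F.1, sound hDF, sound hEF⟩

theorem confluentAt_of_rank_eq_zero {R : TRS L V}
    (hconf : ConfluentOn (Step R) 𝒮.sortedTerms) {t : L.Term V} (ht : plainRank 𝒮 t = 0) :
    ConfluentAt R t := by
  intro u v hu hv
  have ht' : t ∈ 𝒮.sortedTerms := ⟨_, hasSort_of_rank_eq_zero ht⟩
  have restrict : ∀ {w}, ReflTransGen (Step R) t w → w ∈ 𝒮.sortedTerms ∧
      ReflTransGen (fun a b => Step R a b ∧ a ∈ 𝒮.sortedTerms ∧ b ∈ 𝒮.sortedTerms) t w := by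
    intro w h
    induction h with
    | refl => exact ⟨ht', .refl⟩
    | tail _ h ih =>
      have := hconf.1 _ ih.1 _ h
      exact ⟨this, ih.2.tail ⟨h, ih.1, this⟩⟩
  obtain ⟨d, hud, hvd⟩ := hconf.2 t u v
    (restrict (steps_iff.1 hu)).2 (restrict (steps_iff.1 hv)).2
  exact ⟨d, steps_iff.2 (hud.lift id fun _ _ h => h.1),
    steps_iff.2 (hvd.lift id fun _ _ h => h.1)⟩

end Holes

end OrderSorted

theorem mainTheorem11 {L : FirstOrder.Language.{u, v}} {V : Type w} [Countable V]
    {S : Type z} [PartialOrder S] (𝒮 : OrderSorted.SortAttachment L V S)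
    (hV : ∀ α : S, (𝒮.varsOfSort α).Infinite) (R : OrderSorted.TRS L V)
    (hcompat : 𝒮.Compatible R) (hll : OrderSorted.LeftLinear R)
    (hconf : OrderSorted.ConfluentOn (OrderSorted.Step R) 𝒮.sortedTerms) :
    OrderSorted.Confluent (OrderSorted.Step R) := by
  have all : ∀ r t, OrderSorted.plainRank 𝒮 t ≤ r → OrderSorted.ConfluentAt R t := by
    intro r
    induction r with
    | zero => exact fun t ht =>
      OrderSorted.confluentAt_of_rank_eq_zero hconf (Nat.le_zero.1 ht)
    | succ r ih => exact fun t ht => OrderSorted.confluentAt_succ hV hcompat hll ih ht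
  intro a b c hb hc
  obtain ⟨d, h1, h2⟩ := all _ a le_rfl b c (OrderSorted.steps_iff.2 hb) (OrderSorted.steps_iff.2 hc)
  exact ⟨d, OrderSorted.steps_iff.1 h1, OrderSorted.steps_iff.1 h2⟩
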